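/- Let $H$ be a separable infinite-dimensional complex Hilbert space. For a positive compact operator $a$ on $H$ let $\lambda_1(a)\ge\lambda_2(a)\ge\cdots$ be the eigenvalues of $a$ in decreasing order, counted with multiplicity (the positive eigenvalues, followed by zeros if $a$ has finite rank). Let $\alpha:\{0,1,2,\dots\}\to[0,\infty)$ be monotone increasing (in the weak sense) with $\alpha(0)=0$ and $\alpha(1)>0$, and define the non-linear trace of Sugeno type associated with $\alpha$ by $$\psi_\alpha(a)=\sup_{n\ge 1}\,\min\{\lambda_n(a),\alpha(n)\}\in[0,\infty].$$ Then for every positive compact operator $a$ on $H$, $$\psi_\alpha(a)=\max\{\lambda\in[0,\infty)\;:\;\text{there is a finite-rank orthogonal projection } p \text{ on } H \text{ with } \lambda\le\alpha(\dim p)\text{ and } pap\ge\lambda p\},$$ where $\dim p$ is the dimension of the range of $p$; in particular $\psi_\alpha(a)$ is finite and the maximum is attained. -/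

import Mathlib

open scoped NNReal ENNReal

section SugenoTrace

variable {H : Type*} [NormedAddCommGroup H] [InnerProductSpace ℂ H]

/-- The linear span of all eigenvectors of `a` whose eigenvalue is a real number `s ≥ t`.
For a positive operator the eigenspaces are mutually orthogonal, so the dimension of this space
is the number of eigenvalues `≥ t` of `a`, counted with multiplicity. -/
def eigenspaceGE (a : H →L[ℂ] H) (t : ℝ≥0) : Submodule ℂ H :=
  ⨆ s : ℝ≥0, ⨆ _ : t ≤ s, Module.End.eigenspace (a : H →ₗ[ℂ] H) ((s : ℝ) : ℂ)

/-- The eigenvalue sequence `λ₁(a) ≥ λ₂(a) ≥ ⋯` of a positive compact operator `a`: the eigenvalues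
of `a` in decreasing order, counted with multiplicity, followed by zeros if `a` has finite rank.
Its `n`-th term (`n ≥ 1`) is the largest `t > 0` such that at least `n` eigenvalues of `a`, counted
with multiplicity, are `≥ t`, and it is `0` (the supremum of the empty set in `ℝ≥0`) if
`a` has fewer than `n` positive eigenvalues. -/
noncomputable def eigenvalueSeq (a : H →L[ℂ] H) (n : ℕ) : ℝ≥0 :=
  sSup {t : ℝ≥0 | 0 < t ∧ (n : Cardinal) ≤ Module.rank ℂ (eigenspaceGE a t)}

/-- The non-linear trace of Sugeno type associated with `α`,
`ψ_α(a) = ⋁_{n ≥ 1} (λ_n(a) ∧ α(n))`, with values in `[0, ∞]`. -/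
noncomputable def sugenoTrace (α : ℕ → ℝ≥0) (a : H →L[ℂ] H) : ℝ≥0∞ :=
  ⨆ n : ℕ, ⨆ _ : 1 ≤ n, ((eigenvalueSeq a n ⊓ α n : ℝ≥0) : ℝ≥0∞)

end SugenoTrace

/-!
By Cauchy–Schwarz, a compact operator `a` is bounded below on any subspace where its quadratic form
dominates `t‖x‖²` with `t > 0`, so such a subspace has finite dimension. On the span `E_t` of the
eigenvectors with eigenvalue at least `t` the form does dominate `t‖x‖²`, while at the nonzero
vectors of `E_tᗮ` it is strictly smaller, because the norm of `a` restricted to `E_tᗮ`, if positive,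
is an eigenvalue. Hence every subspace on which the form dominates `t‖x‖²` meets `E_tᗮ` trivially
and has dimension at most `dim E_t`. Applied to `E_s`, which is constant for `s` slightly below `t`,
this gives `E_s = E_t`, so the supremum defining `λ_n(a)` is attained. The max-min principle
follows: `t ≤ λ_n(a)` if and only if there is an `n`-dimensional projection `p` with `t p ≤ p a p`.
Finally, only finitely many `λ_n(a)` exceed a given positive number, so the supremum defining
`ψ_α(a)` is a maximum.
-/

open Module Module.End

section LinearAlgebra

theorem exists_submodule_le_finrank_eq {K V : Type*} [DivisionRing K] [AddCommGroup V] [Module K V]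
    {F : Submodule K V} {n : ℕ} (hn : n ≤ finrank K F) : ∃ G ≤ F, finrank K G = n := by
  obtain ⟨v, hv⟩ := exists_linearIndependent_of_le_finrank hn
  refine ⟨Submodule.span K (Set.range (F.subtype ∘ v)), ?_, ?_⟩
  · rw [Submodule.span_le]
    rintro _ ⟨i, rfl⟩
    exact (v i).2
  · rw [finrank_span_eq_card (hv.map' F.subtype F.ker_subtype), Fintype.card_fin]

end LinearAlgebra

section Order

theorem exists_forall_le_of_finite_setOf_le {ι L : Type*} [Nonempty ι] [LinearOrder L] [OrderBot L]
    {f : ι → L} (hf : ∀ r, ⊥ < r → {i | r ≤ f i}.Finite) : ∃ i, ∀ j, f j ≤ f i := by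
  by_cases! h : ∃ k, ⊥ < f k
  · obtain ⟨k, hk⟩ := h
    obtain ⟨i, hi, hmax⟩ := (hf _ hk).exists_maximalFor f _ ⟨k, le_rfl⟩
    refine ⟨i, fun j => ?_⟩
    rcases le_total (f k) (f j) with hkj | hjk
    · exact (le_total (f j) (f i)).elim id (hmax hkj)
    · exact hjk.trans hi
  · exact ⟨Classical.arbitrary ι, fun j => (h j).trans bot_le⟩

end Order

section QuadraticForm

variable {𝕜 E : Type*} [RCLike 𝕜] [NormedAddCommGroup E] [InnerProductSpace 𝕜 E] {a : E →L[𝕜] E}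

theorem finrank_le_of_disjoint_orthogonal {F U : Submodule 𝕜 E} [FiniteDimensional 𝕜 U]
    (h : Disjoint F Uᗮ) : finrank 𝕜 F ≤ finrank 𝕜 U := by
  let P : E →ₗ[𝕜] U := U.orthogonalProjectionOnto
  have hP : LinearMap.ker (P.domRestrict F) = ⊥ := by
    rw [LinearMap.ker_eq_bot']
    intro x hx
    exact Subtype.ext <| Submodule.disjoint_def.1 h x x.2
      (Submodule.orthogonalProjectionOnto_eq_zero_iff.1 hx)
  exact LinearMap.finrank_le_finrank_of_injective (LinearMap.ker_eq_bot.1 hP)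

theorem reApplyInnerSelf_le_norm_apply_mul_norm (a : E →L[𝕜] E) (x : E) :
    a.reApplyInnerSelf x ≤ ‖a x‖ * ‖x‖ :=
  re_inner_le_norm (a x) x

theorem mul_norm_le_norm_apply {t : ℝ} {x : E} (h : t * ‖x‖ ^ 2 ≤ a.reApplyInnerSelf x) :
    t * ‖x‖ ≤ ‖a x‖ := by
  rcases (norm_nonneg x).eq_or_lt with hx | hx
  · simp only [← hx, mul_zero, norm_nonneg]
  · refine le_of_mul_le_mul_right ?_ hx
    calc t * ‖x‖ * ‖x‖ = t * ‖x‖ ^ 2 := by ring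
      _ ≤ ‖a x‖ * ‖x‖ := h.trans (reApplyInnerSelf_le_norm_apply_mul_norm a x)

theorem finiteDimensional_of_mul_sq_norm_le_reApplyInnerSelf [CompleteSpace E]
    (ha : IsCompactOperator a) {t : ℝ} (ht : 0 < t) {F : Submodule 𝕜 E}
    (hF : ∀ x ∈ F, t * ‖x‖ ^ 2 ≤ a.reApplyInnerSelf x) : FiniteDimensional 𝕜 F := by
  let V := F.topologicalClosure
  have : CompleteSpace V := F.isClosed_topologicalClosure.completeSpace_coe
  have hV : ∀ x ∈ V, t * ‖x‖ ≤ ‖a x‖ := fun x hx =>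
    closure_minimal (t := {x | t * ‖x‖ ≤ ‖a x‖}) (fun y hy => mul_norm_le_norm_apply (hF y hy))
      (isClosed_le (by fun_prop) (by fun_prop)) hx
  let aV : V →L[𝕜] E := a ∘L V.subtypeL
  have haV : IsCompactOperator aV := ha.comp_clm V.subtypeL
  have hanti : AntilipschitzWith t.toNNReal⁻¹ aV := aV.antilipschitz_of_bound fun x => by
    rw [NNReal.coe_inv, Real.coe_toNNReal t ht.le, inv_mul_eq_div, le_div_iff₀' ht]
    exact hV x x.2
  obtain ⟨K, hK, hKa⟩ := haV
  have hid : IsCompactOperator (id : V → V) :=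
    ⟨aV ⁻¹' K, (hanti.isClosedEmbedding aV.uniformContinuous).isCompact_preimage hK, hKa⟩
  have : FiniteDimensional 𝕜 V := .of_isCompactOperator_id hid
  exact Submodule.finiteDimensional_of_le F.le_topologicalClosure

theorem mul_sq_norm_le_reApplyInnerSelf_of_mem_iSup_eigenspace (ha : a.IsSymmetric) {t : ℝ} {x : E}
    (hx : x ∈ ⨆ s : Set.Ici t, eigenspace (a : E →ₗ[𝕜] E) ((s : ℝ) : 𝕜)) :
    t * ‖x‖ ^ 2 ≤ a.reApplyInnerSelf x := by
  have horth := ha.orthogonalFamily_eigenspaces.comp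
    (RCLike.ofReal_injective.comp Subtype.val_injective : Function.Injective
      fun s : Set.Ici t => ((s : ℝ) : 𝕜))
  obtain ⟨f, hf, rfl⟩ := (Submodule.mem_iSup_iff_exists_finsupp _ _).1 hx
  let v (s : Set.Ici t) : eigenspace (a : E →ₗ[𝕜] E) ((s : ℝ) : 𝕜) := ⟨f s, hf s⟩
  have hmap : a (f.sum fun _ y => y) = ∑ s ∈ f.support, ((s : ℝ) : 𝕜) • f s := by
    rw [Finsupp.sum, map_sum]
    exact Finset.sum_congr rfl fun s _ => mem_eigenspace_iff.1 (hf s)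
  have hnorm : ‖f.sum fun _ y => y‖ ^ 2 = ∑ s ∈ f.support, ‖f s‖ ^ 2 := horth.norm_sum v f.support
  have hinner : inner 𝕜 (a (f.sum fun _ y => y)) (f.sum fun _ y => y) =
      ∑ s ∈ f.support, inner 𝕜 (((s : ℝ) : 𝕜) • f s) (f s) := by
    rw [hmap]
    exact horth.inner_sum (fun s => ((s : ℝ) : 𝕜) • v s) v f.support
  calc t * ‖f.sum fun _ y => y‖ ^ 2 = ∑ s ∈ f.support, t * ‖f s‖ ^ 2 := by
        rw [hnorm, Finset.mul_sum]
    _ ≤ ∑ s ∈ f.support, (s : ℝ) * ‖f s‖ ^ 2 :=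
        Finset.sum_le_sum fun s _ => mul_le_mul_of_nonneg_right s.2 (sq_nonneg _)
    _ = a.reApplyInnerSelf (f.sum fun _ y => y) := by
        simp only [ContinuousLinearMap.reApplyInnerSelf_apply, hinner, map_sum, inner_smul_left,
          RCLike.conj_ofReal, RCLike.re_ofReal_mul, inner_self_eq_norm_sq]

theorem hasEigenvalue_norm [CompleteSpace E] (hc : IsCompactOperator a) (ha : a.IsPositive)
    (h0 : a ≠ 0) : HasEigenvalue (a : E →ₗ[𝕜] E) ((‖a‖ : ℝ) : 𝕜) := by
  have : Nontrivial E := by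
    by_contra! h
    exact h0 (Subsingleton.elim _ _)
  rw [hc.hasEigenvalue_iff_mem_spectrum (by simpa using h0)]
  by_contra h
  obtain ⟨ε, hε, hle⟩ := a.rayleighQuotient_le_of_norm_mem_resolventSet (Set.notMem_compl_iff.1 h)
  have hsup : ⨆ x, |a.rayleighQuotient x| ≤ ‖a‖ - ε := ciSup_le fun x => by
    rw [abs_of_nonneg (div_nonneg (ha.2 x) (sq_nonneg _))]
    exact hle x
  rw [← a.norm_eq_iSup_rayleighQuotient ha.isSymmetric] at hsup
  linarith

section Compression

variable [CompleteSpace E] {p : E →L[𝕜] E}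

theorem nonneg_conj_starProjection_iff (ha : IsSelfAdjoint a) (hp : IsStarProjection p) :
    0 ≤ p * a * p ↔ ∀ x ∈ LinearMap.range (p : E →ₗ[𝕜] E), 0 ≤ a.reApplyInnerSelf x := by
  have hform (x : E) : (p * a * p).reApplyInnerSelf x = a.reApplyInnerSelf (p x) :=
    congrArg RCLike.re (hp.isSelfAdjoint.isSymmetric (a (p x)) x)
  rw [ContinuousLinearMap.nonneg_iff_isPositive, ContinuousLinearMap.isPositive_def']
  simp only [ha.conjugate_self hp.isSelfAdjoint, hform, true_and, LinearMap.mem_range,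
    forall_exists_index, forall_apply_eq_imp_iff, ContinuousLinearMap.coe_coe]

theorem smul_starProjection_le_conj_iff (ha : IsSelfAdjoint a) (hp : IsStarProjection p) (t : ℝ) :
    (t : 𝕜) • p ≤ p * a * p ↔
      ∀ x ∈ LinearMap.range (p : E →ₗ[𝕜] E), t * ‖x‖ ^ 2 ≤ a.reApplyInnerSelf x := by
  have hconj : p * a * p - (t : 𝕜) • p = p * (a - (t : 𝕜) • 1) * p := by
    simp only [mul_sub, sub_mul, mul_smul_comm, smul_mul_assoc, mul_one, hp.isIdempotentElem.eq]
  have ht : IsSelfAdjoint (t : 𝕜) := RCLike.conj_ofReal t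
  have hself : IsSelfAdjoint (a - (t : 𝕜) • (1 : E →L[𝕜] E)) := ha.sub (ht.smul (.one _))
  have hform (x : E) : (a - (t : 𝕜) • (1 : E →L[𝕜] E)).reApplyInnerSelf x =
      a.reApplyInnerSelf x - t * ‖x‖ ^ 2 := by
    simp only [ContinuousLinearMap.reApplyInnerSelf_apply, sub_apply, smul_apply,
      one_apply_eq_self, inner_sub_left, inner_smul_left, map_sub, RCLike.conj_ofReal,
      RCLike.re_ofReal_mul, inner_self_eq_norm_sq]
  rw [ContinuousLinearMap.le_def, hconj, ← ContinuousLinearMap.nonneg_iff_isPositive,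
    nonneg_conj_starProjection_iff hself hp]
  simp only [hform, sub_nonneg]

end Compression

end QuadraticForm

section EigenspaceGE

variable {H : Type*} [NormedAddCommGroup H] [InnerProductSpace ℂ H] {a : H →L[ℂ] H}

theorem eigenspace_le_eigenspaceGE (a : H →L[ℂ] H) {s t : ℝ≥0} (h : t ≤ s) :
    eigenspace (a : H →ₗ[ℂ] H) ((s : ℝ) : ℂ) ≤ eigenspaceGE a t :=
  le_iSup₂_of_le s h le_rfl

theorem eigenspaceGE_antitone (a : H →L[ℂ] H) : Antitone (eigenspaceGE a) := fun _ _ h =>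
  iSup₂_le fun _ hs => eigenspace_le_eigenspaceGE a (h.trans hs)

theorem eigenspaceGE_mem_invtSubmodule (a : H →L[ℂ] H) (t : ℝ≥0) :
    eigenspaceGE a t ∈ invtSubmodule (a : H →ₗ[ℂ] H) := by
  suffices eigenspaceGE a t ≤ (eigenspaceGE a t).comap (a : H →ₗ[ℂ] H) from this
  refine iSup₂_le fun s hs x hx => ?_
  rw [Submodule.mem_comap, mem_eigenspace_iff.1 hx]
  exact Submodule.smul_mem _ _ (eigenspace_le_eigenspaceGE a hs hx)

theorem mul_sq_norm_le_reApplyInnerSelf_of_mem_eigenspaceGE (ha : a.IsSymmetric) {t : ℝ≥0} {x : H}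
    (hx : x ∈ eigenspaceGE a t) : t * ‖x‖ ^ 2 ≤ a.reApplyInnerSelf x :=
  mul_sq_norm_le_reApplyInnerSelf_of_mem_iSup_eigenspace ha <|
    (iSup₂_le fun s hs => le_iSup_of_le (⟨s, hs⟩ : Set.Ici (t : ℝ)) le_rfl :
      eigenspaceGE a t ≤ _) hx

theorem le_nnnorm_of_finrank_eigenspaceGE_pos (ha : a.IsSymmetric) {t : ℝ≥0}
    (h : 0 < finrank ℂ (eigenspaceGE a t)) : t ≤ ‖a‖₊ := by
  have : FiniteDimensional ℂ (eigenspaceGE a t) := .of_finrank_pos h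
  obtain ⟨x, hx⟩ := finrank_pos_iff_exists_ne_zero.1 h
  have hle : t * ‖(x : H)‖ ≤ ‖a‖ * ‖(x : H)‖ :=
    (mul_norm_le_norm_apply (mul_sq_norm_le_reApplyInnerSelf_of_mem_eigenspaceGE ha x.2)).trans
      (a.le_opNorm x)
  have hx0 : (x : H) ≠ 0 := fun h => hx (Subtype.ext h)
  exact NNReal.coe_le_coe.1 (le_of_mul_le_mul_right hle (norm_pos_iff.2 hx0))

variable [CompleteSpace H]

theorem finiteDimensional_eigenspaceGE (hc : IsCompactOperator a) (ha : a.IsSymmetric) {t : ℝ≥0}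
    (ht : 0 < t) : FiniteDimensional ℂ (eigenspaceGE a t) :=
  finiteDimensional_of_mul_sq_norm_le_reApplyInnerSelf hc (NNReal.coe_pos.2 ht)
    fun _ => mul_sq_norm_le_reApplyInnerSelf_of_mem_eigenspaceGE ha

theorem norm_restrict_orthogonal_eigenspaceGE_lt (hc : IsCompactOperator a) (ha : a.IsPositive)
    {t : ℝ≥0} (ht : 0 < t) (hinv : ∀ x ∈ (eigenspaceGE a t)ᗮ, a x ∈ (eigenspaceGE a t)ᗮ) :
    ‖a.restrict hinv‖ < t := by
  set b := a.restrict hinv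
  have hbc : IsCompactOperator b := hc.restrict' (f := (a : H →ₗ[ℂ] H)) hinv
  have hb : b.IsPositive := ⟨ha.isSymmetric.restrict_invariant hinv, fun x => ha.2 x⟩
  by_contra! hle
  have hb0 : b ≠ 0 := by
    intro h
    rw [h, ContinuousLinearMap.opNorm_zero] at hle
    exact hle.not_gt (NNReal.coe_pos.2 ht)
  obtain ⟨v, hv, hv0⟩ := (hasEigenvalue_norm hbc hb hb0).exists_hasEigenvector
  have hvt : (v : H) ∈ eigenspaceGE a t := eigenspace_le_eigenspaceGE a (s := ‖b‖₊) hle <|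
    mem_eigenspace_iff.2 (congrArg Subtype.val (mem_eigenspace_iff.1 hv))
  exact hv0 (Subtype.ext (Submodule.disjoint_def.1 (Submodule.orthogonal_disjoint _) _ hvt v.2))

theorem reApplyInnerSelf_lt_of_mem_orthogonal_eigenspaceGE (hc : IsCompactOperator a)
    (ha : a.IsPositive) {t : ℝ≥0} (ht : 0 < t) {x : H} (hx : x ∈ (eigenspaceGE a t)ᗮ)
    (hx0 : x ≠ 0) : a.reApplyInnerSelf x < t * ‖x‖ ^ 2 := by
  have hinv : ∀ y ∈ (eigenspaceGE a t)ᗮ, a y ∈ (eigenspaceGE a t)ᗮ :=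
    ContinuousLinearMap.orthogonal_mem_invtSubmodule
      (ha.isSelfAdjoint.adjoint_eq.symm ▸ eigenspaceGE_mem_invtSubmodule a t)
  have hnorm := norm_restrict_orthogonal_eigenspaceGE_lt hc ha ht hinv
  have : 0 < ‖x‖ := norm_pos_iff.2 hx0
  calc a.reApplyInnerSelf x ≤ ‖a x‖ * ‖x‖ := reApplyInnerSelf_le_norm_apply_mul_norm a x
    _ ≤ ‖a.restrict hinv‖ * ‖x‖ * ‖x‖ := by
        gcongr
        exact (a.restrict hinv).le_opNorm ⟨x, hx⟩
    _ = ‖a.restrict hinv‖ * ‖x‖ ^ 2 := by ring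
    _ < t * ‖x‖ ^ 2 := by gcongr

theorem finrank_le_finrank_eigenspaceGE (hc : IsCompactOperator a) (ha : a.IsPositive) {t : ℝ≥0}
    (ht : 0 < t) {F : Submodule ℂ H} (hF : ∀ x ∈ F, t * ‖x‖ ^ 2 ≤ a.reApplyInnerSelf x) :
    finrank ℂ F ≤ finrank ℂ (eigenspaceGE a t) := by
  have := finiteDimensional_eigenspaceGE hc ha.isSymmetric ht
  refine finrank_le_of_disjoint_orthogonal (Submodule.disjoint_def.2 fun x hxF hx => ?_)
  by_contra hx0
  exact (hF x hxF).not_gt (reApplyInnerSelf_lt_of_mem_orthogonal_eigenspaceGE hc ha ht hx hx0)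

theorem exists_lt_forall_eigenspaceGE_eq (hc : IsCompactOperator a) (ha : a.IsSymmetric) {m : ℝ≥0}
    (hm : 0 < m) :
    ∃ s, 0 < s ∧ s < m ∧ ∀ t, s ≤ t → t < m → eigenspaceGE a t = eigenspaceGE a s := by
  obtain ⟨s, ⟨hs, hsm⟩, hmin⟩ := exists_minimalFor_of_wellFoundedLT
    (fun t : ℝ≥0 => 0 < t ∧ t < m) (fun t => finrank ℂ (eigenspaceGE a t)) (exists_between hm)
  refine ⟨s, hs, hsm, fun t hst htm => ?_⟩
  have := finiteDimensional_eigenspaceGE hc ha hs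
  have hle := eigenspaceGE_antitone a hst
  exact Submodule.eq_of_le_of_finrank_le hle
    (hmin ⟨hs.trans_le hst, htm⟩ (Submodule.finrank_mono hle))

theorem exists_lt_eigenspaceGE_eq (hc : IsCompactOperator a) (ha : a.IsPositive) {m : ℝ≥0}
    (hm : 0 < m) : ∃ s, 0 < s ∧ s < m ∧ eigenspaceGE a m = eigenspaceGE a s := by
  obtain ⟨s, hs, hsm, hconst⟩ := exists_lt_forall_eigenspaceGE_eq hc ha.isSymmetric hm
  have := finiteDimensional_eigenspaceGE hc ha.isSymmetric hs
  refine ⟨s, hs, hsm, Submodule.eq_of_le_of_finrank_le (eigenspaceGE_antitone a hsm.le) <|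
    finrank_le_finrank_eigenspaceGE hc ha hm fun x hx => ?_⟩
  have hlim : Filter.Tendsto (fun t : ℝ≥0 => (t : ℝ) * ‖x‖ ^ 2) (nhdsWithin m (Set.Iio m))
      (nhds (m * ‖x‖ ^ 2)) :=
    (Continuous.tendsto (by fun_prop) m).mono_left nhdsWithin_le_nhds
  have : (nhdsWithin m (Set.Iio m)).NeBot := nhdsLT_neBot_of_exists_lt ⟨s, hsm⟩
  refine le_of_tendsto hlim ?_
  filter_upwards [Ico_mem_nhdsLT hsm] with t ht
  exact mul_sq_norm_le_reApplyInnerSelf_of_mem_eigenspaceGE ha.isSymmetric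
    (hconst t ht.1 ht.2 ▸ hx)

end EigenspaceGE

section EigenvalueSeq

variable {H : Type*} [NormedAddCommGroup H] [InnerProductSpace ℂ H] [CompleteSpace H]
  {a : H →L[ℂ] H}

theorem natCast_le_rank_eigenspaceGE_iff (hc : IsCompactOperator a) (ha : a.IsSymmetric) {t : ℝ≥0}
    (ht : 0 < t) {n : ℕ} :
    (n : Cardinal) ≤ Module.rank ℂ (eigenspaceGE a t) ↔ n ≤ finrank ℂ (eigenspaceGE a t) := by
  have := finiteDimensional_eigenspaceGE hc ha ht
  rw [← finrank_eq_rank, Nat.cast_le]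

theorem le_finrank_eigenspaceGE_of_le_eigenvalueSeq (hc : IsCompactOperator a) (ha : a.IsPositive)
    {n : ℕ} {t : ℝ≥0} (ht : 0 < t) (h : t ≤ eigenvalueSeq a n) :
    n ≤ finrank ℂ (eigenspaceGE a t) := by
  obtain ⟨s, hs, hst, heq⟩ := exists_lt_eigenspaceGE_eq hc ha ht
  have := finiteDimensional_eigenspaceGE hc ha.isSymmetric hs
  obtain ⟨r, ⟨hr, hn⟩, hsr⟩ := exists_lt_of_lt_csSup' (hst.trans_le h)
  calc n ≤ finrank ℂ (eigenspaceGE a r) :=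
        (natCast_le_rank_eigenspaceGE_iff hc ha.isSymmetric hr).1 hn
    _ ≤ finrank ℂ (eigenspaceGE a s) := Submodule.finrank_mono (eigenspaceGE_antitone a hsr.le)
    _ = finrank ℂ (eigenspaceGE a t) := by rw [heq]

theorem le_eigenvalueSeq_of_le_finrank_eigenspaceGE (hc : IsCompactOperator a) (ha : a.IsSymmetric)
    {n : ℕ} (hn : 1 ≤ n) {t : ℝ≥0} (ht : 0 < t) (h : n ≤ finrank ℂ (eigenspaceGE a t)) :
    t ≤ eigenvalueSeq a n := by
  refine le_csSup ⟨‖a‖₊, fun s hs => ?_⟩ ⟨ht, (natCast_le_rank_eigenspaceGE_iff hc ha ht).2 h⟩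
  exact le_nnnorm_of_finrank_eigenspaceGE_pos ha <|
    hn.trans ((natCast_le_rank_eigenspaceGE_iff hc ha hs.1).1 hs.2)

theorem le_eigenvalueSeq_iff_exists_submodule (hc : IsCompactOperator a) (ha : a.IsPositive) {n : ℕ}
    (hn : 1 ≤ n) {t : ℝ≥0} (ht : 0 < t) :
    t ≤ eigenvalueSeq a n ↔ ∃ F : Submodule ℂ H, finrank ℂ F = n ∧
      ∀ x ∈ F, t * ‖x‖ ^ 2 ≤ a.reApplyInnerSelf x := by
  constructor
  · intro h
    obtain ⟨F, hF, hFn⟩ := exists_submodule_le_finrank_eq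
      (le_finrank_eigenspaceGE_of_le_eigenvalueSeq hc ha ht h)
    exact ⟨F, hFn, fun x hx =>
      mul_sq_norm_le_reApplyInnerSelf_of_mem_eigenspaceGE ha.isSymmetric (hF hx)⟩
  · rintro ⟨F, rfl, hF⟩
    exact le_eigenvalueSeq_of_le_finrank_eigenspaceGE hc ha.isSymmetric hn ht
      (finrank_le_finrank_eigenspaceGE hc ha ht hF)

theorem le_eigenvalueSeq_iff_exists_isStarProjection (hc : IsCompactOperator a) (ha : a.IsPositive)
    {n : ℕ} (hn : 1 ≤ n) {t : ℝ≥0} (ht : 0 < t) :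
    t ≤ eigenvalueSeq a n ↔ ∃ p : H →L[ℂ] H, IsStarProjection p ∧
      finrank ℂ (LinearMap.range (p : H →ₗ[ℂ] H)) = n ∧ ((t : ℝ) : ℂ) • p ≤ p * a * p := by
  rw [le_eigenvalueSeq_iff_exists_submodule hc ha hn ht]
  constructor
  · rintro ⟨F, hFn, hF⟩
    have : FiniteDimensional ℂ F := .of_finrank_pos (hFn ▸ hn)
    have hp : IsStarProjection F.starProjection := isStarProjection_starProjection
    refine ⟨F.starProjection, hp, by rwa [F.range_starProjection], ?_⟩
    refine (smul_starProjection_le_conj_iff ha.isSelfAdjoint hp t).2 ?_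
    rwa [F.range_starProjection]
  · rintro ⟨p, hp, hpn, hle⟩
    exact ⟨_, hpn, (smul_starProjection_le_conj_iff ha.isSelfAdjoint hp t).1 hle⟩

theorem finite_setOf_le_eigenvalueSeq (hc : IsCompactOperator a) (ha : a.IsPositive) {t : ℝ≥0}
    (ht : 0 < t) : {n | t ≤ eigenvalueSeq a n}.Finite :=
  (Set.finite_Iic _).subset fun _ => le_finrank_eigenspaceGE_of_le_eigenvalueSeq hc ha ht

end EigenvalueSeq

section Sugeno

variable {H : Type*} [NormedAddCommGroup H] [InnerProductSpace ℂ H] {a : H →L[ℂ] H}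

theorem le_sugenoTrace (α : ℕ → ℝ≥0) (a : H →L[ℂ] H) {n : ℕ} (hn : 1 ≤ n) :
    ((eigenvalueSeq a n ⊓ α n : ℝ≥0) : ℝ≥0∞) ≤ sugenoTrace α a :=
  le_iSup₂_of_le n hn le_rfl

theorem exists_sugenoTrace_eq [CompleteSpace H] (hc : IsCompactOperator a) (ha : a.IsPositive)
    (α : ℕ → ℝ≥0) :
    ∃ n, 1 ≤ n ∧ sugenoTrace α a = ((eigenvalueSeq a n ⊓ α n : ℝ≥0) : ℝ≥0∞) := by
  have : Nonempty {n : ℕ // 1 ≤ n} := ⟨1, le_rfl⟩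
  obtain ⟨⟨n, hn⟩, hmax⟩ := exists_forall_le_of_finite_setOf_le
    (f := fun n : {n : ℕ // 1 ≤ n} => eigenvalueSeq a n ⊓ α n) fun r hr =>
      ((finite_setOf_le_eigenvalueSeq hc ha hr).preimage Subtype.val_injective.injOn).subset
        fun n h => (le_trans h inf_le_left : r ≤ eigenvalueSeq a n)
  exact ⟨n, hn, (iSup₂_le fun j hj => ENNReal.coe_le_coe.2 (hmax ⟨j, hj⟩)).antisymm
    (le_sugenoTrace α a hn)⟩

end Sugeno

theorem mainTheorem9_general {H : Type*} [NormedAddCommGroup H] [InnerProductSpace ℂ H]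
    [CompleteSpace H] (α : ℕ → ℝ≥0) (hα0 : α 0 = 0)
    (a : H →L[ℂ] H) (ha : IsCompactOperator a) (ha0 : 0 ≤ a) :
    IsGreatest
      ((fun l : ℝ≥0 => (l : ℝ≥0∞)) '' {l : ℝ≥0 | ∃ p : H →L[ℂ] H,
        IsStarProjection p ∧ FiniteDimensional ℂ (LinearMap.range (p : H →ₗ[ℂ] H)) ∧
        l ≤ α (finrank ℂ (LinearMap.range (p : H →ₗ[ℂ] H))) ∧
        ((l : ℝ) : ℂ) • p ≤ p * a * p})
      (sugenoTrace α a) := by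
  have hpos : a.IsPositive := (ContinuousLinearMap.nonneg_iff_isPositive a).1 ha0
  constructor
  · obtain ⟨n, hn, htrace⟩ := exists_sugenoTrace_eq ha hpos α
    refine ⟨_, ?_, htrace.symm⟩
    rcases eq_zero_or_pos (eigenvalueSeq a n ⊓ α n) with h0 | h0
    · refine ⟨0, .zero _, ?_, by simp [h0], by simp⟩
      rw [ContinuousLinearMap.toLinearMap_zero, LinearMap.range_zero]
      infer_instance
    · obtain ⟨p, hp, hpn, hle⟩ :=
        (le_eigenvalueSeq_iff_exists_isStarProjection ha hpos hn h0).1 inf_le_left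
      exact ⟨p, hp, .of_finrank_pos (hpn ▸ hn), hpn ▸ inf_le_right, hle⟩
  · rintro _ ⟨l, ⟨p, hp, -, hl, hle⟩, rfl⟩
    rcases eq_zero_or_pos l with rfl | hl0
    · exact bot_le
    have hn : 1 ≤ finrank ℂ (LinearMap.range (p : H →ₗ[ℂ] H)) :=
      Nat.one_le_iff_ne_zero.2 fun h => (hl.trans_eq (by rw [h, hα0])).not_gt hl0
    have hlambda :=
      (le_eigenvalueSeq_iff_exists_isStarProjection ha hpos hn hl0).2 ⟨p, hp, rfl, hle⟩
    exact (ENNReal.coe_le_coe.2 (le_inf hlambda hl)).trans (le_sugenoTrace α a hn)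

theorem mainTheorem9 {H : Type*} [NormedAddCommGroup H] [InnerProductSpace ℂ H] [CompleteSpace H]
    [TopologicalSpace.SeparableSpace H] (hH : ¬ FiniteDimensional ℂ H)
    (α : ℕ → ℝ≥0) (hα : Monotone α) (hα0 : α 0 = 0) (hα1 : 0 < α 1)
    (a : H →L[ℂ] H) (ha : IsCompactOperator a) (ha0 : 0 ≤ a) :
    IsGreatest
      ((fun l : ℝ≥0 => (l : ℝ≥0∞)) '' {l : ℝ≥0 | ∃ p : H →L[ℂ] H,
        IsStarProjection p ∧ FiniteDimensional ℂ (LinearMap.range (p : H →ₗ[ℂ] H)) ∧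
        l ≤ α (Module.finrank ℂ (LinearMap.range (p : H →ₗ[ℂ] H))) ∧
        ((l : ℝ) : ℂ) • p ≤ p * a * p})
      (sugenoTrace α a) := by
  exact mainTheorem9_general α hα0 a ha ha0
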